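/- Let $m,n\ge 0$ be integers, $N=mn$, and let $q\in\mathbb C^\times$ not be a root of unity; put $q^x=e^{x\log q}$ and $$h(x)=q\,\frac{q^{-2x}-q^{-2}}{q^{-2x}-1},\qquad g(x)=h(x)h(-x).$$ Let $M$ be the field of meromorphic functions $f(\underline\lambda)=f(\lambda_1,\dots,\lambda_N)$ on $\mathfrak h^*=\mathbb C^N$, with standard basis $\omega(1),\dots,\omega(N)$. **The algebra $\mathscr F_R(M(N))$** is the associative unital $\mathbb C$-algebra generated by $t_{ij}$ ($1\le i,j\le N$) and two copies of $M$ (as subalgebras), written $\mu_l(f)=f(\underline\lambda)$ and $\mu_r(f)=f(\underline\mu)$, with the relations $$f_1(\underline\lambda)f_2(\underline\mu)=f_2(\underline\mu)f_1(\underline\lambda),\quad f(\underline\lambda)t_{ij}=t_{ij}f(\underline\lambda+\omega(i)),\quad f(\underline\mu)t_{ij}=t_{ij}f(\underline\mu+\omega(j)),$$ $h(\mu_k-\mu_l)t_{ik}t_{il}=t_{il}t_{ik}$ for $k<l$, $\;h(\lambda_j-\lambda_i)t_{jk}t_{ik}=t_{ik}t_{jk}$ for $i<j$, and, for $i<j$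 and $k<l$, $$\begin{aligned} t_{ik}t_{jl}&=t_{jl}t_{ik}+(h(\lambda_j-\lambda_i)-h(\mu_k-\mu_l))\,t_{jk}t_{il},\\ g(\mu_k-\mu_l)t_{ik}t_{jl}&=g(\lambda_i-\lambda_j)t_{jl}t_{ik}+(h(\mu_l-\mu_k)-h(\lambda_i-\lambda_j))\,t_{il}t_{jk},\\ g(\mu_k-\mu_l)t_{jk}t_{il}&=t_{il}t_{jk}+(h(\mu_l-\mu_k)-h(\lambda_j-\lambda_i))\,t_{jl}t_{ik},\\ g(\lambda_i-\lambda_j)t_{jk}t_{il}&=t_{il}t_{jk}+(h(\mu_l-\mu_k)-h(\lambda_j-\lambda_i))\,t_{ik}t_{jl}. \end{aligned}$$ It is bigraded by $\mathbb N^N\times\mathbb N^N$: $f(\underline\lambda),f(\underline\mu)$ have bidegree $(0,0)$ and $t_{ij}$ has bidegree $(\omega(i),\omega(j))$. Let $\mathscr F_{\alpha\beta}$ be its components. **Signs and minors.** For $I=\{i_1<\dots<i_r\}$ and $J=\{j_1<\dots<j_r\}$ in $[1,N]$ and $\sigma\in S_r$ put $$S(\sigma,I)=\prod_{k<l,\ \sigma(k)>\sigma(l)}\bigl(-h(\lambda_{i_{\sigma(k)}}-\lambda_{i_{\sigma(l)}})\bigr)\in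 M,\qquad S(\sigma)=S(\sigma,[1,N])\ \text{ if } r=N.$$ The dynamical quantum minor is $$\xi^I_J=\mu_r(S(\rho,J)^{-1})\sum_{\sigma\in S_r}\mu_l(S(\sigma,I))\,t_{i_{\sigma(1)}j_{\rho(1)}}\cdots t_{i_{\sigma(r)}j_{\rho(r)}},$$ where $\rho\in S_r$ may be chosen arbitrarily for each minor; $\det(T)=\xi^{[1,N]}_{[1,N]}$. **The algebra $\mathcal B$** is the unital $\mathbb C$-algebra generated by $M$ (as a subalgebra) and elements $b_I=b_{i_1\cdots i_m}$, one for each $I=\{i_1<\dots<i_m\}\subseteq[1,N]$, without further relations. It is graded by $\mathbb N^N$: $f\in M$ has degree $0$ and $b_I$ has degree $\omega(i_1)+\dots+\omega(i_m)$. **The tensor product** $\mathscr F_R(M(N))\,\widetilde\otimes\,\mathcal B$ is the quotient algebra of the subalgebra $\bigoplus_{\alpha,\beta}\mathscr F_{\alpha\beta}\otimes\mathcal B_\beta$ of $\mathscr F_R(M(N))\otimes_{\mathbb C}\mathcal B$ by the relations $\mu_r(f)a\otimes y=a\otimes fy$ ($f\in M$, $a\in\mathscr F_{\alpha\beta}$,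 $y\in\mathcal B_\beta$). The field $M$ acts on it by $f(a\otimes y)=\mu_l(f)a\otimes y$. **Hyper-Pfaffian.** Let $\Pi$ be the set of permutations $\sigma$ of $[1,mn]$ with $\sigma((k-1)m+1)<\dots<\sigma(km)$ for $k=1,\dots,n$. For a family $X=(x_I)$ indexed by the $m$-element subsets $I$ of $[1,mn]$, with values in $\mathcal B$ or in $\mathscr F_R(M(mn))\widetilde\otimes\mathcal B$, put $$\mathrm{Pf}_m(X)=\sum_{\sigma\in\Pi}S(\sigma)\,x_{\sigma(1)\cdots\sigma(m)}\cdots x_{\sigma(m(n-1)+1)\cdots\sigma(mn)}.$$ **Theorem.** Let $B=(b_I)$ and $C=(c_I)$, where $c_I=\sum_J\xi^I_J\otimes b_J$ (sum over the $m$-element subsets $J$ of $[1,mn]$). Then in $\mathscr F_R(M(mn))\,\widetilde\otimes\,\mathcal B$ $$\mathrm{Pf}_m(C)=\det(T)\otimes\mathrm{Pf}_m(B).$$ -/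

import Mathlib

open scoped TensorProduct

noncomputable section

namespace DynPf

/-! ### Meromorphic functions on `𝔥* = ℂ^N` -/

/-- The algebra of entire functions on `𝔥* = ℂ^N`. -/
def entire (N : ℕ) : Subalgebra ℂ ((Fin N → ℂ) → ℂ) where
  carrier := {f | AnalyticOnNhd ℂ f Set.univ}
  mul_mem' := fun hf hg => hf.mul hg
  add_mem' := fun hf hg => hf.add hg
  algebraMap_mem' := fun c => (analyticOnNhd_const : AnalyticOnNhd ℂ (fun _ : Fin N → ℂ => c) _)

instance instIsDomainEntire (N : ℕ) : IsDomain (entire N) := by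
  have : NoZeroDivisors (entire N) := by
    refine ⟨fun {f g} hfg => ?_⟩
    by_contra hne
    push Not at hne
    obtain ⟨hf, hg⟩ := hne
    apply hf
    obtain ⟨x, hx⟩ : ∃ x, g.1 x ≠ 0 := by
      by_contra hcon
      push Not at hcon
      exact hg (Subtype.ext (funext hcon))
    have hev : ∀ᶠ y in nhds x, g.1 y ≠ 0 :=
      (g.2 x (Set.mem_univ x)).continuousAt.eventually_ne hx
    have hz : f.1 =ᶠ[nhds x] (0 : (Fin N → ℂ) → ℂ) := by
      filter_upwards [hev] with y hy
      have h := congrFun (congrArg Subtype.val hfg) y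
      exact (mul_eq_zero.mp h).resolve_right hy
    exact Subtype.ext (AnalyticOnNhd.eq_of_eventuallyEq f.2
      (analyticOnNhd_const : AnalyticOnNhd ℂ (fun _ : Fin N → ℂ => (0 : ℂ)) _) hz)
  exact NoZeroDivisors.to_isDomain _

/-- The field `M_{𝔥*}` of meromorphic functions on `𝔥* = ℂ^N`: a meromorphic function on `ℂ^N` is
a quotient of two entire functions. -/
abbrev Mero (N : ℕ) : Type := FractionRing (entire N)

/-- Translation of entire functions, `(T_α f)(λ) = f(λ + α)`. -/
def entireShift {N : ℕ} (α : Fin N → ℂ) : entire N ≃+* entire N where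
  toFun f := ⟨fun x => f.1 (x + α), fun x _ => (f.2 (x + α) (Set.mem_univ _)).comp_of_eq
    (analyticAt_id.add analyticAt_const) rfl⟩
  invFun f := ⟨fun x => f.1 (x - α), fun x _ => (f.2 (x - α) (Set.mem_univ _)).comp_of_eq
    (analyticAt_id.sub analyticAt_const) rfl⟩
  left_inv f := Subtype.ext (funext fun x => congrArg f.1 (by simp))
  right_inv f := Subtype.ext (funext fun x => congrArg f.1 (by simp))
  map_mul' _ _ := rfl
  map_add' _ _ := rfl

/-- The automorphism `T_α` of `M_{𝔥*}`, `(T_α f)(λ) = f(λ + α)`. -/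
def shift {N : ℕ} (α : Fin N → ℂ) : Mero N ≃+* Mero N :=
  IsFractionRing.ringEquivOfRingEquiv (entireShift α)

/-- The weight `ω(i) = e_i`, as an element of `ℕ^N`. -/
def wt {N : ℕ} (i : Fin N) : Fin N → ℕ := Pi.single i 1

/-- A weight in `ℕ^N`, seen in `𝔥* = ℂ^N`. -/
def wtC {N : ℕ} (α : Fin N → ℕ) : Fin N → ℂ := fun i => (α i : ℂ)

/-- The meromorphic function `q^{-2(λ_i - λ_j)}` of `λ`, where `q^x = exp (x log q)`. -/
def qpow (q : ℂ) {N : ℕ} (i j : Fin N) : Mero N :=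
  algebraMap (entire N) (Mero N)
    ⟨fun x => Complex.exp (-2 * Complex.log q * (x i - x j)), fun x _ => by
      have hp : ∀ k : Fin N, AnalyticAt ℂ (fun y : Fin N → ℂ => y k) x := fun k =>
        (ContinuousLinearMap.proj (R := ℂ) (φ := fun _ : Fin N => ℂ) k).analyticAt x
      exact (analyticAt_const.mul ((hp i).sub (hp j))).cexp⟩

/-- The meromorphic function `h(λ_i - λ_j)` of `λ`, where
`h(x) = q (q^{-2x} - q^{-2}) / (q^{-2x} - 1)`. -/
def hfun (q : ℂ) {N : ℕ} (i j : Fin N) : Mero N :=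
  algebraMap ℂ (Mero N) q * (qpow q i j - algebraMap ℂ (Mero N) ((q ^ 2)⁻¹)) / (qpow q i j - 1)

/-- The meromorphic function `g(λ_i - λ_j)` of `λ`, where `g(x) = h(x) h(-x)`. -/
def gfun (q : ℂ) {N : ℕ} (i j : Fin N) : Mero N := hfun q i j * hfun q j i

/-! ### The algebra `F_R(M(N))` -/

/-- Generators of `F_R(M(N))`: two copies `f(λ)`, `f(μ)` of `M_{𝔥*}`, and the `t_{ij}`. -/
inductive FGen (N : ℕ) : Type
  | lam (f : Mero N)
  | mu (f : Mero N)
  | t (i j : Fin N)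

/-- `f(λ)` in the free algebra. -/
def L {N : ℕ} (f : Mero N) : FreeAlgebra ℂ (FGen N) := FreeAlgebra.ι ℂ (FGen.lam f)

/-- `f(μ)` in the free algebra. -/
def R {N : ℕ} (f : Mero N) : FreeAlgebra ℂ (FGen N) := FreeAlgebra.ι ℂ (FGen.mu f)

/-- `t_{ij}` in the free algebra. -/
def T {N : ℕ} (i j : Fin N) : FreeAlgebra ℂ (FGen N) := FreeAlgebra.ι ℂ (FGen.t i j)

/-- Defining relations of `F_R(M(N))`: the two copies of `M_{𝔥*}` are subalgebras, which commute
with each other and are moved past `t_{ij}` by shifts, and the `t_{ij}` satisfy the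
Faddeev-Reshetikhin-Takhtajan-Sklyanin relations
`∑ R^{xy}_{ac}(λ) t_{xb} t_{yd} = ∑ R^{bd}_{xy}(μ) t_{cy} t_{ax}` of the trigonometric dynamical
R-matrix, written out: `row` is the case of equal rows, `col` the case of equal columns, and the
last four are the four cases of distinct rows and distinct columns. -/
inductive FRel (q : ℂ) (N : ℕ) : FreeAlgebra ℂ (FGen N) → FreeAlgebra ℂ (FGen N) → Prop
  | lam_add (f g : Mero N) : FRel q N (L (f + g)) (L f + L g)
  | lam_mul (f g : Mero N) : FRel q N (L (f * g)) (L f * L g)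
  | lam_const (c : ℂ) : FRel q N (L (algebraMap ℂ (Mero N) c)) (algebraMap ℂ _ c)
  | mu_add (f g : Mero N) : FRel q N (R (f + g)) (R f + R g)
  | mu_mul (f g : Mero N) : FRel q N (R (f * g)) (R f * R g)
  | mu_const (c : ℂ) : FRel q N (R (algebraMap ℂ (Mero N) c)) (algebraMap ℂ _ c)
  | lam_mu (f g : Mero N) : FRel q N (L f * R g) (R g * L f)
  | lam_t (f : Mero N) (i j : Fin N) :
      FRel q N (L f * T i j) (T i j * L (shift (wtC (wt i)) f))
  | mu_t (f : Mero N) (i j : Fin N) :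
      FRel q N (R f * T i j) (T i j * R (shift (wtC (wt j)) f))
  | row (i k l : Fin N) (hkl : k < l) :
      FRel q N (R (hfun q k l) * (T i k * T i l)) (T i l * T i k)
  | col (i j k : Fin N) (hij : i < j) :
      FRel q N (L (hfun q j i) * (T j k * T i k)) (T i k * T j k)
  | exch₁ (i j k l : Fin N) (hij : i < j) (hkl : k < l) :
      FRel q N (T i k * T j l)
        (T j l * T i k + (L (hfun q j i) - R (hfun q k l)) * (T j k * T i l))
  | exch₂ (i j k l : Fin N) (hij : i < j) (hkl : k < l) :
      FRel q N (R (gfun q k l) * (T i k * T j l))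
        (L (gfun q i j) * (T j l * T i k)
          + (R (hfun q l k) - L (hfun q i j)) * (T i l * T j k))
  | exch₃ (i j k l : Fin N) (hij : i < j) (hkl : k < l) :
      FRel q N (R (gfun q k l) * (T j k * T i l))
        (T i l * T j k + (R (hfun q l k) - L (hfun q j i)) * (T j l * T i k))
  | exch₄ (i j k l : Fin N) (hij : i < j) (hkl : k < l) :
      FRel q N (L (gfun q i j) * (T j k * T i l))
        (T i l * T j k + (R (hfun q l k) - L (hfun q j i)) * (T i k * T j l))

/-- The `𝔥`-algebra `F_R(M(N))`. -/
abbrev FR (q : ℂ) (N : ℕ) : Type := RingQuot (FRel q N)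

/-- The generator `t_{ij}` of `F_R(M(N))`. -/
def t (q : ℂ) {N : ℕ} (i j : Fin N) : FR q N := RingQuot.mkAlgHom ℂ (FRel q N) (T i j)

/-- The left moment map `μ_l(f) = f(λ)`. -/
def muL (q : ℂ) (N : ℕ) : Mero N →ₐ[ℂ] FR q N where
  toFun f := RingQuot.mkAlgHom ℂ (FRel q N) (L f)
  map_one' := by
    have h := RingQuot.mkAlgHom_rel ℂ (FRel.lam_const (q := q) (N := N) 1)
    simpa using h
  map_mul' f g := by rw [RingQuot.mkAlgHom_rel ℂ (FRel.lam_mul f g), map_mul]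
  map_zero' := by
    have h := RingQuot.mkAlgHom_rel ℂ (FRel.lam_const (q := q) (N := N) 0)
    simpa using h
  map_add' f g := by rw [RingQuot.mkAlgHom_rel ℂ (FRel.lam_add f g), map_add]
  commutes' c := by rw [RingQuot.mkAlgHom_rel ℂ (FRel.lam_const c), AlgHom.commutes]

/-- The right moment map `μ_r(f) = f(μ)`. -/
def muR (q : ℂ) (N : ℕ) : Mero N →ₐ[ℂ] FR q N where
  toFun f := RingQuot.mkAlgHom ℂ (FRel q N) (R f)
  map_one' := by
    have h := RingQuot.mkAlgHom_rel ℂ (FRel.mu_const (q := q) (N := N) 1)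
    simpa using h
  map_mul' f g := by rw [RingQuot.mkAlgHom_rel ℂ (FRel.mu_mul f g), map_mul]
  map_zero' := by
    have h := RingQuot.mkAlgHom_rel ℂ (FRel.mu_const (q := q) (N := N) 0)
    simpa using h
  map_add' f g := by rw [RingQuot.mkAlgHom_rel ℂ (FRel.mu_add f g), map_add]
  commutes' c := by rw [RingQuot.mkAlgHom_rel ℂ (FRel.mu_const c), AlgHom.commutes]

/-- Monomials of `F_R(M(N))` and their bidegrees: `f(λ)` and `f(μ)` have bidegree `(0, 0)`,
`t_{ij}` has bidegree `(ω(i), ω(j))`. -/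
inductive FMonomial (q : ℂ) (N : ℕ) : (Fin N → ℕ) → (Fin N → ℕ) → FR q N → Prop
  | lam (f : Mero N) : FMonomial q N 0 0 (muL q N f)
  | mu (f : Mero N) : FMonomial q N 0 0 (muR q N f)
  | t (i j : Fin N) : FMonomial q N (wt i) (wt j) (t q i j)
  | mul (α β α' β' : Fin N → ℕ) (x y : FR q N) : FMonomial q N α β x → FMonomial q N α' β' y →
      FMonomial q N (α + α') (β + β') (x * y)

/-- The homogeneous component of `F_R(M(N))` of bidegree `(α, β)`. -/
def FDeg (q : ℂ) (N : ℕ) (α β : Fin N → ℕ) : Submodule ℂ (FR q N) :=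
  Submodule.span ℂ {x | FMonomial q N α β x}

/-! ### Generalized signs and dynamical quantum minors -/

/-- The increasing sequences `i_1 < ⋯ < i_r` in `[1, N]`, i.e. the `r`-element subsets. -/
abbrev Idx (r N : ℕ) : Type := Fin r ↪o Fin N

instance instFintypeIdx (r N : ℕ) : Fintype (Idx r N) :=
  Fintype.ofInjective (fun I : Idx r N => (I : Fin r → Fin N)) DFunLike.coe_injective

/-- The generalized sign
`S(σ, I)(λ) = ∏_{k < l, σ(k) > σ(l)} (-h(λ_{i_{σ(k)}} - λ_{i_{σ(l)}}))`. -/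
def S (q : ℂ) {r N : ℕ} (σ : Equiv.Perm (Fin r)) (I : Idx r N) : Mero N :=
  ∏ p : Fin r × Fin r with p.1 < p.2 ∧ σ p.2 < σ p.1, -hfun q (I (σ p.1)) (I (σ p.2))

/-- The dynamical quantum minor `ξ^I_J`, written with the help of `ρ ∈ S_r`:
`μ_r(S(ρ, J)⁻¹) ∑_σ μ_l(S(σ, I)) t_{i_{σ(1)} j_{ρ(1)}} ⋯ t_{i_{σ(r)} j_{ρ(r)}}`. -/
def minor (q : ℂ) {r N : ℕ} (ρ : Equiv.Perm (Fin r)) (I J : Idx r N) : FR q N :=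
  muR q N (S q ρ J)⁻¹ * ∑ σ : Equiv.Perm (Fin r),
    muL q N (S q σ I) * (List.ofFn fun k : Fin r => t q (I (σ k)) (J (ρ k))).prod

/-- The dynamical quantum determinant `det(T) = ξ^{[1,N]}_{[1,N]}`. -/
def qdet (q : ℂ) {N : ℕ} (ρ : Equiv.Perm (Fin N)) : FR q N :=
  minor q ρ (RelEmbedding.refl _) (RelEmbedding.refl _)

/-- The weight `ω(i_1) + ⋯ + ω(i_r)` of `I`. -/
def wtIdx {r N : ℕ} (I : Idx r N) : Fin N → ℕ := ∑ k, wt (I k)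

/-! ### The algebra `B` -/

/-- Generators of `B`: a copy `f(λ)` of `M_{𝔥*}`, and the `b_{i_1 ⋯ i_m}`, `i_1 < ⋯ < i_m`. -/
inductive BGen (m N : ℕ) : Type
  | fn (f : Mero N)
  | b (I : Idx m N)

/-- Defining relations of `B`: the copy of `M_{𝔥*}` is a subalgebra. -/
inductive BRel (m N : ℕ) : FreeAlgebra ℂ (BGen m N) → FreeAlgebra ℂ (BGen m N) → Prop
  | fn_add (f g : Mero N) : BRel m N (FreeAlgebra.ι ℂ (BGen.fn (f + g)))
      (FreeAlgebra.ι ℂ (BGen.fn f) + FreeAlgebra.ι ℂ (BGen.fn g))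
  | fn_mul (f g : Mero N) : BRel m N (FreeAlgebra.ι ℂ (BGen.fn (f * g)))
      (FreeAlgebra.ι ℂ (BGen.fn f) * FreeAlgebra.ι ℂ (BGen.fn g))
  | fn_const (c : ℂ) : BRel m N (FreeAlgebra.ι ℂ (BGen.fn (algebraMap ℂ (Mero N) c)))
      (algebraMap ℂ _ c)

/-- The algebra `B` generated by `M_{𝔥*}` and the `b_I`. -/
abbrev BAlg (m N : ℕ) : Type := RingQuot (BRel m N)

/-- The generator `b_I` of `B`. -/
def b {m N : ℕ} (I : Idx m N) : BAlg m N :=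
  RingQuot.mkAlgHom ℂ (BRel m N) (FreeAlgebra.ι ℂ (BGen.b I))

/-- The copy of `M_{𝔥*}` in `B`. -/
def fnB (m N : ℕ) : Mero N →ₐ[ℂ] BAlg m N where
  toFun f := RingQuot.mkAlgHom ℂ (BRel m N) (FreeAlgebra.ι ℂ (BGen.fn f))
  map_one' := by
    have h := RingQuot.mkAlgHom_rel ℂ (BRel.fn_const (m := m) (N := N) 1)
    simpa using h
  map_mul' f g := by rw [RingQuot.mkAlgHom_rel ℂ (BRel.fn_mul f g), map_mul]
  map_zero' := by
    have h := RingQuot.mkAlgHom_rel ℂ (BRel.fn_const (m := m) (N := N) 0)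
    simpa using h
  map_add' f g := by rw [RingQuot.mkAlgHom_rel ℂ (BRel.fn_add f g), map_add]
  commutes' c := by rw [RingQuot.mkAlgHom_rel ℂ (BRel.fn_const c), AlgHom.commutes]

/-- Monomials of `B` and their weights: `f(λ)` has weight `0`, `b_I` has weight `ω(I)`. -/
inductive BMonomial (m N : ℕ) : (Fin N → ℕ) → BAlg m N → Prop
  | fn (f : Mero N) : BMonomial m N 0 (fnB m N f)
  | b (I : Idx m N) : BMonomial m N (wtIdx I) (b I)
  | mul (β β' : Fin N → ℕ) (x y : BAlg m N) : BMonomial m N β x → BMonomial m N β' y →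
      BMonomial m N (β + β') (x * y)

/-- The homogeneous component of `B` of weight `β`. -/
def BDeg (m N : ℕ) (β : Fin N → ℕ) : Submodule ℂ (BAlg m N) :=
  Submodule.span ℂ {x | BMonomial m N β x}

/-! ### The tensor product `F_R(M(N)) ⊗~ B` -/

/-- The subalgebra `⨁_{α, β} F_{α β} ⊗ B_β` of `F_R(M(N)) ⊗ B`. It is the linear span of the set
below, since that set is closed under products. -/
def preTensor (q : ℂ) (m N : ℕ) : Subalgebra ℂ (FR q N ⊗[ℂ] BAlg m N) :=
  Algebra.adjoin ℂ {x | ∃ α β : Fin N → ℕ, ∃ a ∈ FDeg q N α β, ∃ y ∈ BDeg m N β, x = a ⊗ₜ[ℂ] y}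

/-- `a ⊗ y`, for `a ∈ F_{α β}` and `y ∈ B_β`. -/
def preTmul {q : ℂ} {m N : ℕ} {α β : Fin N → ℕ} (a : FDeg q N α β) (y : BDeg m N β) :
    preTensor q m N :=
  ⟨(a : FR q N) ⊗ₜ[ℂ] (y : BAlg m N),
    Algebra.subset_adjoin ⟨α, β, a, a.2, y, y.2, rfl⟩⟩

/-- The relations `μ_r(f) a ⊗ y = a ⊗ f y` of the tensor product. -/
inductive TensorRel (q : ℂ) (m N : ℕ) : preTensor q m N → preTensor q m N → Prop
  | mk (f : Mero N) {α β : Fin N → ℕ} (a a' : FDeg q N α β) (y y' : BDeg m N β)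
      (ha : (a' : FR q N) = muR q N f * a) (hy : (y' : BAlg m N) = fnB m N f * y) :
      TensorRel q m N (preTmul a' y) (preTmul a y')

/-- The algebra `F_R(M(N)) ⊗~ B`, with the product `(a ⊗ y)(a' ⊗ y') = a a' ⊗ y y'`. -/
abbrev TensorAlg (q : ℂ) (m N : ℕ) : Type := RingQuot (TensorRel q m N)

/-- The class of `a ⊗ y` in `F_R(M(N)) ⊗~ B`, for `a ∈ F_{α β}` and `y ∈ B_β`. -/
def tmul {q : ℂ} {m N : ℕ} {α β : Fin N → ℕ} (a : FDeg q N α β) (y : BDeg m N β) :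
    TensorAlg q m N :=
  RingQuot.mkAlgHom ℂ (TensorRel q m N) (preTmul a y)

/-- The element `μ_l(f) ⊗ 1`, multiplication by which is the action `f (a ⊗ y) = μ_l(f) a ⊗ y` of
`M_{𝔥*}` on `F_R(M(N)) ⊗~ B`. -/
def fnT (q : ℂ) (m N : ℕ) : Mero N →ₐ[ℂ] TensorAlg q m N :=
  (RingQuot.mkAlgHom ℂ (TensorRel q m N)).comp
    ((Algebra.TensorProduct.includeLeft.comp (muL q N)).codRestrict (preTensor q m N) fun f =>
      Algebra.subset_adjoin ⟨0, 0, muL q N f, Submodule.subset_span (FMonomial.lam f), 1,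
        Submodule.subset_span (by simpa using BMonomial.fn (m := m) (N := N) 1), rfl⟩)

/-! ### The dynamical quantum hyper-Pfaffian -/

/-- The permutations `σ` of `[1, nm]` that increase on each of the `n` consecutive blocks of length
`m`; `finProdFinEquiv (k, s)` is the `s`-th position of the `k`-th block. -/
abbrev Shuffle (m n : ℕ) : Type :=
  {σ : Equiv.Perm (Fin (n * m)) // ∀ k : Fin n, StrictMono fun s : Fin m => σ (finProdFinEquiv (k, s))}

instance instFintypeShuffle (m n : ℕ) : Fintype (Shuffle m n) := Fintype.ofFinite _

/-- The increasing sequence `σ((k-1)m+1) < ⋯ < σ(km)` of the `k`-th block. -/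
def block {m n : ℕ} (σ : Shuffle m n) (k : Fin n) : Idx m (n * m) :=
  OrderEmbedding.ofStrictMono (fun s : Fin m => σ.1 (finProdFinEquiv (k, s))) (σ.2 k)

/-- The dynamical quantum hyper-Pfaffian
`Pf_m(X) = ∑_{σ ∈ Π} S(σ) x_{σ(1) ⋯ σ(m)} ⋯ x_{σ(m(n-1)+1) ⋯ σ(mn)}` of a family `x_I` in an
algebra in which `M_{𝔥*}` acts through `φ`. -/
def hyperPf (q : ℂ) {m n : ℕ} {A : Type} [Semiring A] [Algebra ℂ A] (φ : Mero (n * m) →ₐ[ℂ] A)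
    (x : Idx m (n * m) → A) : A :=
  ∑ σ : Shuffle m n, φ (S q σ.1 (RelEmbedding.refl _)) * (List.ofFn fun k : Fin n => x (block σ k)).prod

/-- `Pf_m(B)`, in `B`. -/
def pfB (q : ℂ) (m n : ℕ) : BAlg m (n * m) := hyperPf q (fnB m (n * m)) b

/-! ### Homogeneity -/

theorem FDeg.mul_mem {q : ℂ} {N : ℕ} {α β α' β' : Fin N → ℕ} {x y : FR q N}
    (hx : x ∈ FDeg q N α β) (hy : y ∈ FDeg q N α' β') : x * y ∈ FDeg q N (α + α') (β + β') := by
  have h := Submodule.mul_mem_mul hx hy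
  rw [FDeg, FDeg, Submodule.span_mul_span] at h
  refine Submodule.span_mono ?_ h
  rintro _ ⟨u, hu, v, hv, rfl⟩
  exact FMonomial.mul _ _ _ _ _ _ hu hv

theorem BDeg.mul_mem {m N : ℕ} {β β' : Fin N → ℕ} {x y : BAlg m N}
    (hx : x ∈ BDeg m N β) (hy : y ∈ BDeg m N β') : x * y ∈ BDeg m N (β + β') := by
  have h := Submodule.mul_mem_mul hx hy
  rw [BDeg, BDeg, Submodule.span_mul_span] at h
  refine Submodule.span_mono ?_ h
  rintro _ ⟨u, hu, v, hv, rfl⟩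
  exact BMonomial.mul _ _ _ _ hu hv

theorem FDeg.prod_mem {q : ℂ} {N : ℕ} : ∀ {r : ℕ} (α β : Fin r → Fin N → ℕ) (x : Fin r → FR q N),
    (∀ k, x k ∈ FDeg q N (α k) (β k)) → (List.ofFn x).prod ∈ FDeg q N (∑ k, α k) (∑ k, β k)
  | 0, _, _, _, _ => by
    have h : (1 : FR q N) ∈ FDeg q N 0 0 :=
      Submodule.subset_span (by simpa using FMonomial.lam (q := q) (N := N) 1)
    simpa using h
  | r + 1, α, β, x, h => by
    rw [List.ofFn_succ, List.prod_cons, Fin.sum_univ_succ, Fin.sum_univ_succ]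
    exact FDeg.mul_mem (h 0) (FDeg.prod_mem _ _ _ fun k => h k.succ)

theorem BDeg.prod_mem {m N : ℕ} : ∀ {r : ℕ} (β : Fin r → Fin N → ℕ) (x : Fin r → BAlg m N),
    (∀ k, x k ∈ BDeg m N (β k)) → (List.ofFn x).prod ∈ BDeg m N (∑ k, β k)
  | 0, _, _, _ => by
    have h : (1 : BAlg m N) ∈ BDeg m N 0 :=
      Submodule.subset_span (by simpa using BMonomial.fn (m := m) (N := N) 1)
    simpa using h
  | r + 1, β, x, h => by
    rw [List.ofFn_succ, List.prod_cons, Fin.sum_univ_succ]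
    exact BDeg.mul_mem (h 0) (BDeg.prod_mem _ _ fun k => h k.succ)

theorem minor_mem (q : ℂ) {r N : ℕ} (ρ : Equiv.Perm (Fin r)) (I J : Idx r N) :
    minor q ρ I J ∈ FDeg q N (wtIdx I) (wtIdx J) := by
  have h1 : ∑ σ : Equiv.Perm (Fin r),
      muL q N (S q σ I) * (List.ofFn fun k : Fin r => t q (I (σ k)) (J (ρ k))).prod
      ∈ FDeg q N (wtIdx I) (wtIdx J) := by
    refine Submodule.sum_mem _ fun σ _ => ?_
    have h2 := FDeg.prod_mem (fun k => wt (I (σ k))) (fun k => wt (J (ρ k)))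
      (fun k => t q (I (σ k)) (J (ρ k))) fun k => Submodule.subset_span (FMonomial.t _ _)
    rw [Equiv.sum_comp σ (fun k => wt (I k)), Equiv.sum_comp ρ (fun k => wt (J k))] at h2
    have h3 := FDeg.mul_mem (Submodule.subset_span (FMonomial.lam (S q σ I))) h2
    rwa [zero_add, zero_add] at h3
  have h4 := FDeg.mul_mem (Submodule.subset_span (FMonomial.mu (S q ρ J)⁻¹)) h1
  rwa [zero_add, zero_add] at h4

theorem qdet_mem (q : ℂ) {N : ℕ} (ρ : Equiv.Perm (Fin N)) :
    qdet q ρ ∈ FDeg q N (wtIdx (RelEmbedding.refl _ : Idx N N))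
      (wtIdx (RelEmbedding.refl _ : Idx N N)) :=
  minor_mem q ρ _ _

theorem b_mem {m N : ℕ} (I : Idx m N) : b I ∈ BDeg m N (wtIdx I) :=
  Submodule.subset_span (BMonomial.b I)

theorem pfB_mem (q : ℂ) (m n : ℕ) :
    pfB q m n ∈ BDeg m (n * m) (wtIdx (RelEmbedding.refl _ : Idx (n * m) (n * m))) := by
  refine Submodule.sum_mem _ fun σ _ => ?_
  have h1 := BDeg.prod_mem (fun k => wtIdx (block σ k)) (fun k => b (block σ k)) fun k => b_mem _
  have h2 : ∑ k, wtIdx (block σ k) = wtIdx (RelEmbedding.refl _ : Idx (n * m) (n * m)) := by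
    have h3 : ∑ k, wtIdx (block σ k)
        = ∑ p : Fin n × Fin m, wt (σ.1 (finProdFinEquiv p)) := by
      rw [Fintype.sum_prod_type]
      rfl
    rw [h3, Equiv.sum_comp finProdFinEquiv (fun p => wt (σ.1 p)),
      Equiv.sum_comp σ.1 (fun p => wt p)]
    rfl
  rw [h2] at h1
  have h3 := BDeg.mul_mem (Submodule.subset_span (BMonomial.fn (m := m)
    (S q σ.1 (RelEmbedding.refl _)))) h1
  rwa [zero_add] at h3

/-- The element `c_I = ∑_J ξ^I_J ⊗ b_J` of `F_R(M(mn)) ⊗~ B`, where `ξ^I_J` is written with the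
help of the permutation `ρ I J`. -/
def c (q : ℂ) {m n : ℕ} (ρ : Idx m (n * m) → Idx m (n * m) → Equiv.Perm (Fin m))
    (I : Idx m (n * m)) : TensorAlg q m (n * m) :=
  ∑ J : Idx m (n * m), tmul ⟨minor q (ρ I J) I J, minor_mem q (ρ I J) I J⟩ ⟨b J, b_mem J⟩

end DynPf

end

noncomputable section

namespace DynPf

/-! ### Meromorphic functions -/

/-! The identity is a Laplace expansion combined with the dynamical antisymmetry of minors in their
columns. For an arbitrary column sequence `j`, possibly with repetitions, `colMinor q I j` is the
row-antisymmetrized sum of the products of the `t_{i_{σ(k)} j_k}`. Pairing `σ` with `σ * (k k+1)`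
shows that two adjacent columns enter only through the quadratic minors `quadMinor`. These vanish
when the two columns agree, and exchanging the columns multiplies them by a function of `μ`. Hence
`colMinor` vanishes on repeated columns (`colMinor_eq_zero`), and permuting distinct columns by `ρ`
produces `μ_r(S(ρ, J))` (`colMinor_comp_perm`). In particular every choice of `ρ` gives the same
minor (`minor_eq_colMinor`).

Expanding the products in `Pf_m(C)` gives a sum over families `J = (J_1, …, J_n)` of `m`-subsets.
For fixed `J`, the sum over shuffles is the full `colMinor` with the columns of all `J_k`
concatenated (`sum_shuffle_prod_colMinor`): every permutation is uniquely a shuffle times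
permutations inside the blocks, and `S` factors accordingly (`S_mul_blockPerm`). Only families
without a repeated column survive. They are the block families of shuffles `σ`, and each contributes
`μ_r(S(σ)) det(T) ⊗ ∏ b`. The relation `μ_r(f) a ⊗ y = a ⊗ f y` turns `μ_r(S(σ))` into the
coefficient of `Pf_m(B)`. -/

theorem shift_algebraMap {N : ℕ} (α : Fin N → ℂ) (f : entire N) :
    shift α (algebraMap (entire N) (Mero N) f) = algebraMap _ _ (entireShift α f) :=
  IsFractionRing.ringEquivOfRingEquiv_algebraMap (entireShift α) f

theorem shift_const {N : ℕ} (α : Fin N → ℂ) (c : ℂ) :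
    shift α (algebraMap ℂ (Mero N) c) = algebraMap ℂ (Mero N) c := by
  rw [IsScalarTower.algebraMap_apply ℂ (entire N) (Mero N), shift_algebraMap]
  rfl

theorem shift_qpow (q : ℂ) {N : ℕ} {i j k : Fin N} (hi : k ≠ i) (hj : k ≠ j) :
    shift (wtC (wt k)) (qpow q i j) = qpow q i j := by
  rw [qpow, shift_algebraMap]
  congr 1
  apply Subtype.ext
  funext x
  change Complex.exp (-2 * Complex.log q * ((x + wtC (wt k)) i - (x + wtC (wt k)) j)) = _
  simp [wtC, wt, hi.symm, hj.symm]

theorem shift_neg_hfun (q : ℂ) {N : ℕ} {i j k : Fin N} (hi : k ≠ i) (hj : k ≠ j) :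
    shift (wtC (wt k)) (-hfun q i j) = -hfun q i j := by
  -- `h` is a rational expression in `q`, `q⁻²` and `q^{-2x}`, so an endomorphism fixing these three
  -- fixes it.
  have key : ∀ {K : Type} [Field K] (φ : K →+* K) (a b x : K), φ a = a → φ b = b → φ x = x →
      φ (-(a * (x - b) / (x - 1))) = -(a * (x - b) / (x - 1)) := fun φ a b x ha hb hx => by
    rw [map_neg, map_div₀, map_mul, map_sub, map_sub, map_one, ha, hb, hx]
  exact key (shift (wtC (wt k))).toRingHom _ _ _ (shift_const _ _) (shift_const _ _)
    (shift_qpow q hi hj)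

theorem shift_S (q : ℂ) {r N : ℕ} (σ : Equiv.Perm (Fin r)) (I : Idx r N) {k : Fin N}
    (hk : ∀ s, k ≠ I s) : shift (wtC (wt k)) (S q σ I) = S q σ I := by
  rw [S, map_prod]
  exact Finset.prod_congr rfl fun p _ => shift_neg_hfun q (hk _) (hk _)

theorem qpow_ne_const (q : ℂ) {N : ℕ} {i j : Fin N} (x : Fin N → ℂ) (c : ℂ)
    (h : Complex.exp (-2 * Complex.log q * (x i - x j)) ≠ c) :
    qpow q i j ≠ algebraMap ℂ (Mero N) c := by
  intro he
  rw [IsScalarTower.algebraMap_apply ℂ (entire N) (Mero N), qpow] at he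
  have := IsFractionRing.injective (entire N) (Mero N) he
  exact h (congrFun (congrArg Subtype.val this) x)

theorem hfun_ne_zero {q : ℂ} (hq0 : q ≠ 0) (hq2 : q ^ 2 ≠ 1) {N : ℕ} {i j : Fin N} (hij : i ≠ j) :
    hfun q i j ≠ 0 := by
  have h1 : qpow q i j ≠ algebraMap ℂ (Mero N) ((q ^ 2)⁻¹) := by
    -- At the origin `q^{-2x}` takes the value `1`, which differs from `q⁻²`.
    apply qpow_ne_const q 0
    simpa [eq_comm] using hq2
  -- The denominator matters too, since division by zero would make `hfun` zero. At the point `e_i`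
  -- the function takes the value `q⁻² ≠ 1`.
  have h2 : qpow q i j ≠ 1 := by
    rw [← map_one (algebraMap ℂ (Mero N))]
    apply qpow_ne_const q (Pi.single i 1)
    have : (-2 * Complex.log q * ((Pi.single i 1 : Fin N → ℂ) i - (Pi.single i 1 : Fin N → ℂ) j))
        = -(Complex.log q + Complex.log q) := by
      rw [Pi.single_eq_same, Pi.single_eq_of_ne hij.symm]
      ring
    rw [this, Complex.exp_neg, Complex.exp_add, Complex.exp_log hq0, ← sq]
    simpa using hq2
  rw [hfun]
  refine div_ne_zero (mul_ne_zero ?_ (sub_ne_zero.2 h1)) (sub_ne_zero.2 h2)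
  simpa using hq0

theorem neg_hfun_ne_zero {q : ℂ} (hq0 : q ≠ 0) (hq2 : q ^ 2 ≠ 1) {N : ℕ} {i j : Fin N}
    (hij : i ≠ j) : -hfun q i j ≠ 0 :=
  neg_ne_zero.2 (hfun_ne_zero hq0 hq2 hij)

theorem S_ne_zero {q : ℂ} (hq0 : q ≠ 0) (hq2 : q ^ 2 ≠ 1) {r N : ℕ} (σ : Equiv.Perm (Fin r))
    (I : Idx r N) : S q σ I ≠ 0 := by
  refine Finset.prod_ne_zero_iff.2 fun p hp => neg_hfun_ne_zero hq0 hq2 ?_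
  simp only [Finset.mem_filter, Finset.mem_univ, true_and] at hp
  exact fun h => hp.2.ne' (I.injective h)

/-! ### Relations of `F_R(M(N))` -/

section Relations
variable (q : ℂ) {N : ℕ}

theorem muL_muR (f g : Mero N) : Commute (muL q N f) (muR q N g) := by
  have h := RingQuot.mkAlgHom_rel ℂ (FRel.lam_mu (q := q) f g)
  rwa [map_mul, map_mul] at h

theorem muL_t (f : Mero N) (i j : Fin N) :
    muL q N f * t q i j = t q i j * muL q N (shift (wtC (wt i)) f) := by
  have h := RingQuot.mkAlgHom_rel ℂ (FRel.lam_t (q := q) f i j)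
  rwa [map_mul, map_mul] at h

theorem muR_t (f : Mero N) (i j : Fin N) :
    muR q N f * t q i j = t q i j * muR q N (shift (wtC (wt j)) f) := by
  have h := RingQuot.mkAlgHom_rel ℂ (FRel.mu_t (q := q) f i j)
  rwa [map_mul, map_mul] at h

theorem t_col {i j : Fin N} (k : Fin N) (hij : i < j) :
    muL q N (hfun q j i) * (t q j k * t q i k) = t q i k * t q j k := by
  have h := RingQuot.mkAlgHom_rel ℂ (FRel.col (q := q) i j k hij)
  simp only [map_mul] at h
  exact h

theorem t_exch₁ {i j k l : Fin N} (hij : i < j) (hkl : k < l) :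
    t q i k * t q j l = t q j l * t q i k
      + (muL q N (hfun q j i) - muR q N (hfun q k l)) * (t q j k * t q i l) := by
  have h := RingQuot.mkAlgHom_rel ℂ (FRel.exch₁ (q := q) i j k l hij hkl)
  simp only [map_mul, map_add, map_sub] at h
  exact h

theorem t_exch₃ {i j k l : Fin N} (hij : i < j) (hkl : k < l) :
    muR q N (gfun q k l) * (t q j k * t q i l) = t q i l * t q j k
      + (muR q N (hfun q l k) - muL q N (hfun q j i)) * (t q j l * t q i k) := by
  have h := RingQuot.mkAlgHom_rel ℂ (FRel.exch₃ (q := q) i j k l hij hkl)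
  simp only [map_mul, map_add, map_sub] at h
  exact h

theorem commute_muL_t {f : Mero N} {i : Fin N} (j : Fin N) (h : shift (wtC (wt i)) f = f) :
    Commute (muL q N f) (t q i j) := by
  rw [Commute, SemiconjBy, muL_t, h]

theorem commute_muR_t {f : Mero N} (i : Fin N) {j : Fin N} (h : shift (wtC (wt j)) f = f) :
    Commute (muR q N f) (t q i j) := by
  rw [Commute, SemiconjBy, muR_t, h]

/-- The column-ordered quadratic minor `t_{au} t_{bv} - h(λ_b - λ_a) t_{bu} t_{av}`. -/
def quadMinor (a b u v : Fin N) : FR q N :=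
  t q a u * t q b v + muL q N (-hfun q b a) * (t q b u * t q a v)

theorem quadMinor_self {a b : Fin N} (u : Fin N) (hab : a < b) : quadMinor q a b u u = 0 := by
  have key : ∀ {A : Type} [Ring A] (L x y : A), L * y = x → x + -L * y = 0 := by
    rintro A _ L x y rfl
    rw [neg_mul, add_neg_cancel]
  rw [quadMinor, map_neg]
  exact key _ _ _ (t_col q u hab)

/-- By `t_exch₁`, `quadMinor q a b k l` also equals `t_{bl} t_{ak} - h(μ_k - μ_l) t_{bk} t_{al}`.
Multiplying this by `-h(μ_l - μ_k)` creates the term `g(μ_k - μ_l) t_{bk} t_{al}`, which `t_exch₃`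
evaluates. -/
theorem quadMinor_swap {a b k l : Fin N} (hab : a < b) (hkl : k < l) :
    quadMinor q a b l k = muR q N (-hfun q l k) * quadMinor q a b k l := by
  have key : ∀ {A : Type} [Ring A] (L R R' g x y z w : A), x = y + (L - R) * z → g = R' * R →
      g * z = w + (R' - L) * y → w + -L * y = -R' * (x + -L * z) := by
    intro A _ L R R' g x y z w h1 h2 h3
    have h4 : g * z = R' * (R * z) := by rw [h2, mul_assoc]
    have h5 : w = R' * (R * z) - (R' - L) * y := by rw [← h4, h3, add_sub_cancel_right]
    rw [h1, h5]
    noncomm_ring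
  have hg : muR q N (gfun q k l) = muR q N (hfun q l k) * muR q N (hfun q k l) := by
    rw [← map_mul, gfun, mul_comm]
  rw [quadMinor, quadMinor, map_neg, map_neg]
  exact key _ _ _ _ _ _ _ _ (t_exch₁ q hab hkl) hg (t_exch₃ q hab hkl)

/-- For `u < v` the relation `quadMinor_swap` has to be inverted, which uses `h ≠ 0`. The factor
does not depend on the rows. -/
theorem exists_quadMinor_swap {q : ℂ} (hq0 : q ≠ 0) (hq2 : q ^ 2 ≠ 1) {u v : Fin N} (huv : u ≠ v) :
    ∃ f : Mero N, ∀ a b : Fin N, a < b →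
      quadMinor q a b u v = muR q N f * quadMinor q a b v u := by
  rcases huv.lt_or_gt with h | h
  · refine ⟨(-hfun q v u)⁻¹, fun a b hab => ?_⟩
    have hinv : (-hfun q v u)⁻¹ * -hfun q v u = 1 :=
      inv_mul_cancel₀ (neg_hfun_ne_zero hq0 hq2 huv.symm)
    rw [quadMinor_swap q hab h, ← mul_assoc, ← map_mul, hinv, map_one, one_mul]
  · exact ⟨-hfun q u v, fun a b hab => quadMinor_swap q hab h⟩

/-- Since `f'` depends on the columns only, it can be taken out of a sum over row permutations. -/
theorem exists_prod_t_mul_muR {k : ℕ} (y : Fin k → Fin N) (f : Mero N) :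
    ∃ f' : Mero N, ∀ x : Fin k → Fin N,
      (List.ofFn fun i => t q (x i) (y i)).prod * muR q N f
        = muR q N f' * (List.ofFn fun i => t q (x i) (y i)).prod := by
  induction k with
  | zero => exact ⟨f, fun x => by simp⟩
  | succ k ih =>
    obtain ⟨f', hf'⟩ := ih fun i => y i.succ
    refine ⟨(shift (wtC (wt (y 0)))).symm f', fun x => ?_⟩
    rw [List.ofFn_succ, List.prod_cons, mul_assoc, hf' fun i => x i.succ, ← mul_assoc, ← mul_assoc,
      muR_t, RingEquiv.apply_symm_apply]

end Relations

/-! ### Products over `List.ofFn` -/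

theorem prod_ofFn_split {A : Type*} [Monoid A] {r k l : ℕ} (h : r = k + 2 + l) (f : Fin r → A) :
    (List.ofFn f).prod = (List.ofFn fun i : Fin k => f ⟨i, by omega⟩).prod
      * (f ⟨k, by omega⟩ * f ⟨k + 1, by omega⟩)
      * (List.ofFn fun i : Fin l => f ⟨k + 2 + i, by omega⟩).prod := by
  subst h
  rw [List.ofFn_add, List.ofFn_add, List.prod_append, List.prod_append]
  simp only [List.ofFn_succ, List.ofFn_zero, List.prod_cons, List.prod_nil, mul_one]
  rfl

theorem commute_prod_ofFn {A : Type*} [Monoid A] {k : ℕ} {a : A} {f : Fin k → A}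
    (h : ∀ i, Commute a (f i)) : Commute a (List.ofFn f).prod :=
  Commute.list_prod_right _ _ fun x hx => by
    obtain ⟨i, rfl⟩ := (List.mem_ofFn' f x).1 hx
    exact h i

theorem prod_ofFn_mul {A : Type*} [Monoid A] {k : ℕ} {a p : Fin k → A}
    (h : ∀ i j, i ≠ j → Commute (a i) (p j)) :
    (List.ofFn fun i => a i * p i).prod = (List.ofFn a).prod * (List.ofFn p).prod := by
  induction k with
  | zero => simp
  | succ k ih =>
    simp only [List.ofFn_succ, List.prod_cons]
    rw [ih fun i j hij => h _ _ (by simpa using hij)]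
    have hc : Commute (p 0) (List.ofFn fun i : Fin k => a i.succ).prod :=
      commute_prod_ofFn fun i => (h i.succ 0 (Fin.succ_ne_zero i)).symm
    simp only [mul_assoc]
    rw [← mul_assoc (p 0), hc.eq, mul_assoc]

theorem prod_ofFn_sum {A : Type*} [Semiring A] [Algebra ℂ A] {n : ℕ} {ι : Type*}
    [Fintype ι] (x : Fin n → ι → A) :
    (List.ofFn fun k => ∑ i, x k i).prod = ∑ e : Fin n → ι, (List.ofFn fun k => x k (e k)).prod := by
  classical
  simpa using (MultilinearMap.mkPiAlgebraFin ℂ n A).map_sum x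

theorem prod_ofFn_tmul {A B : Type*} [Semiring A] [Algebra ℂ A] [Semiring B] [Algebra ℂ B] {n : ℕ}
    (x : Fin n → A) (y : Fin n → B) :
    (List.ofFn fun k => x k ⊗ₜ[ℂ] y k).prod = (List.ofFn x).prod ⊗ₜ[ℂ] (List.ofFn y).prod := by
  induction n with
  | zero => simp [Algebra.TensorProduct.one_def]
  | succ n ih => simp [List.ofFn_succ, ih]

/-! ### Inversions -/

/-- The product of `F (σ k) (σ l)` over the inversions `k < l`, `σ k > σ l` of `σ`. -/
def invProd {A : Type*} [CommMonoid A] {r : ℕ} (F : Fin r → Fin r → A) (σ : Equiv.Perm (Fin r)) :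
    A := ∏ p : Fin r × Fin r with p.1 < p.2 ∧ σ p.2 < σ p.1, F (σ p.1) (σ p.2)

theorem invProd_eq {A : Type*} [CommMonoid A] {r : ℕ} (F : Fin r → Fin r → A)
    (σ : Equiv.Perm (Fin r)) :
    invProd F σ = ∏ p : Fin r × Fin r with σ.symm p.1 < σ.symm p.2 ∧ p.2 < p.1, F p.1 p.2 := by
  refine Finset.prod_equiv (σ.prodCongr σ) (fun p => ?_) fun p _ => rfl
  simp

theorem swap_succ_lt_iff {r k : ℕ} (hk : k + 1 < r) (x y : Fin r) :
    (Equiv.swap (⟨k, by omega⟩ : Fin r) ⟨k + 1, hk⟩ x < Equiv.swap ⟨k, by omega⟩ ⟨k + 1, hk⟩ y) ↔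
      (x < y ∧ ¬(x = ⟨k, by omega⟩ ∧ y = ⟨k + 1, hk⟩)) ∨
        (x = ⟨k + 1, hk⟩ ∧ y = ⟨k, by omega⟩) := by
  obtain ⟨x, hx⟩ := x
  obtain ⟨y, hy⟩ := y
  simp only [Equiv.swap_apply_def, Fin.mk.injEq]
  split_ifs <;> simp only [Fin.mk_lt_mk] <;> omega

/-- Indexed by values as in `invProd_eq`, the inversions of the new permutation are those of `σ` and
the single pair `(σ (k+1), σ k)`. -/
theorem invProd_mul_swap {A : Type*} [CommMonoid A] {r k : ℕ} (hk : k + 1 < r)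
    (F : Fin r → Fin r → A) (σ : Equiv.Perm (Fin r)) (h : σ ⟨k, by omega⟩ < σ ⟨k + 1, hk⟩) :
    invProd F (σ * Equiv.swap ⟨k, by omega⟩ ⟨k + 1, hk⟩)
      = F (σ ⟨k + 1, hk⟩) (σ ⟨k, by omega⟩) * invProd F σ := by
  classical
  rw [invProd_eq, invProd_eq, ← Finset.prod_insert (a := (σ ⟨k + 1, hk⟩, σ ⟨k, by omega⟩))
    (f := fun p : Fin r × Fin r => F p.1 p.2)]
  · refine Finset.prod_congr ?_ fun _ _ => rfl
    ext ⟨a, b⟩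
    obtain ⟨x, rfl⟩ := σ.surjective a
    obtain ⟨y, rfl⟩ := σ.surjective b
    have e : ∀ z, (σ * Equiv.swap (⟨k, by omega⟩ : Fin r) ⟨k + 1, hk⟩).symm (σ z)
        = Equiv.swap ⟨k, by omega⟩ ⟨k + 1, hk⟩ z := fun z => by
      rw [Equiv.symm_apply_eq]
      simp
    simp only [Finset.mem_filter, Finset.mem_univ, true_and, Finset.mem_insert, Prod.mk.injEq,
      e, Equiv.symm_apply_apply, EmbeddingLike.apply_eq_iff_eq, swap_succ_lt_iff]
    constructor
    · rintro ⟨⟨h1, -⟩ | h1, h2⟩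
      · exact Or.inr ⟨h1, h2⟩
      · exact Or.inl h1
    · rintro (⟨rfl, rfl⟩ | ⟨h1, h2⟩)
      · exact ⟨Or.inr ⟨rfl, rfl⟩, h⟩
      · refine ⟨Or.inl ⟨h1, ?_⟩, h2⟩
        rintro ⟨rfl, rfl⟩
        exact lt_asymm h h2
  · simp

theorem S_eq_invProd (q : ℂ) {r N : ℕ} (σ : Equiv.Perm (Fin r)) (I : Idx r N) :
    S q σ I = invProd (fun a b => -hfun q (I a) (I b)) σ := rfl

/-- Induction on permutations along descents. -/
theorem perm_induction_descent {r : ℕ} {P : Equiv.Perm (Fin r) → Prop} (one : P 1)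
    (step : ∀ (σ : Equiv.Perm (Fin r)) (k : ℕ) (hk : k + 1 < r),
      σ ⟨k, by omega⟩ < σ ⟨k + 1, hk⟩ → P σ → P (σ * Equiv.swap ⟨k, by omega⟩ ⟨k + 1, hk⟩))
    (σ : Equiv.Perm (Fin r)) : P σ := by
  -- With constant factor `2`, `invProd` is `2` to the number of inversions, and removing a descent
  -- halves it.
  induction hM : invProd (fun _ _ => 2 : Fin r → Fin r → ℕ) σ using Nat.strong_induction_on
    generalizing σ with
  | _ M ih =>
    by_cases hd : ∃ k, ∃ hk : k + 1 < r, σ ⟨k + 1, hk⟩ < σ ⟨k, by omega⟩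
    · obtain ⟨k, hk, hd⟩ := hd
      set s : Equiv.Perm (Fin r) := Equiv.swap ⟨k, by omega⟩ ⟨k + 1, hk⟩ with hs
      have hlt : (σ * s) ⟨k, by omega⟩ < (σ * s) ⟨k + 1, hk⟩ := by simpa [hs] using hd
      have hss : σ * s * s = σ := by rw [mul_assoc, hs, Equiv.swap_mul_self, mul_one]
      have hinv := invProd_mul_swap hk (fun _ _ => 2 : Fin r → Fin r → ℕ) (σ * s) hlt
      rw [← hs, hss] at hinv
      have hpos : 0 < invProd (fun _ _ => 2 : Fin r → Fin r → ℕ) (σ * s) :=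
        Finset.prod_pos fun _ _ => two_pos
      have := step (σ * s) k hk hlt (ih _ (by omega) _ rfl)
      rwa [← hs, hss] at this
    · push Not at hd
      have hmono : StrictMono σ := by
        refine Monotone.strictMono_of_injective ?_ σ.injective
        cases r with
        | zero => exact fun x => x.elim0
        | succ r => exact Fin.monotone_iff_le_succ.2 fun i => hd i (by omega)
      have : σ = 1 := by
        have h := hmono.range_inj (strictMono_id (α := Fin r))
        rw [σ.surjective.range_eq, Set.range_id] at h
        exact Equiv.ext fun x => congrFun (h.1 rfl) x
      rwa [this]

/-! ### Row-antisymmetrized products -/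

section ColMinor
variable (q : ℂ) {r N : ℕ}

/-- The sum `∑_σ S(σ, I)(λ) t_{i_{σ(1)} j_1} ⋯ t_{i_{σ(r)} j_r}` for an arbitrary sequence `j` of
columns. -/
def colMinor (I : Idx r N) (j : Fin r → Fin N) : FR q N :=
  ∑ σ : Equiv.Perm (Fin r),
    muL q N (S q σ I) * (List.ofFn fun k : Fin r => t q (I (σ k)) (j k)).prod

theorem S_mul_swap {k : ℕ} (hk : k + 1 < r) (I : Idx r N) (σ : Equiv.Perm (Fin r))
    (h : σ ⟨k, by omega⟩ < σ ⟨k + 1, hk⟩) :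
    S q (σ * Equiv.swap ⟨k, by omega⟩ ⟨k + 1, hk⟩) I
      = S q σ I * -hfun q (I (σ ⟨k + 1, hk⟩)) (I (σ ⟨k, by omega⟩)) := by
  rw [S_eq_invProd, S_eq_invProd, invProd_mul_swap hk _ σ h, mul_comm]

theorem swap_succ_apply_of_ne {k : ℕ} (hk : k + 1 < r) {i : ℕ} (hi : i < r) (h1 : i ≠ k)
    (h2 : i ≠ k + 1) :
    Equiv.swap (⟨k, by omega⟩ : Fin r) ⟨k + 1, hk⟩ ⟨i, hi⟩ = ⟨i, hi⟩ :=
  Equiv.swap_apply_of_ne_of_ne (by simpa using h1) (by simpa using h2)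

theorem sum_perm_eq_sum_swap {A : Type*} [AddCommMonoid A] {k : ℕ} (hk : k + 1 < r)
    (F : Equiv.Perm (Fin r) → A) :
    ∑ σ, F σ = ∑ σ : Equiv.Perm (Fin r) with σ ⟨k, by omega⟩ < σ ⟨k + 1, hk⟩,
      (F σ + F (σ * Equiv.swap ⟨k, by omega⟩ ⟨k + 1, hk⟩)) := by
  classical
  rw [← Finset.sum_filter_add_sum_filter_not Finset.univ
    (fun σ : Equiv.Perm (Fin r) => σ ⟨k, by omega⟩ < σ ⟨k + 1, hk⟩), Finset.sum_add_distrib]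
  congr 1
  refine (Finset.sum_equiv (Equiv.mulRight (Equiv.swap (⟨k, by omega⟩ : Fin r) ⟨k + 1, hk⟩))
    (fun σ => ?_) fun _ _ => rfl).symm
  simp only [Finset.mem_filter, Finset.mem_univ, true_and, Equiv.coe_mulRight,
    Equiv.Perm.mul_apply, Equiv.swap_apply_left, Equiv.swap_apply_right, not_lt]
  refine ⟨le_of_lt, fun h => lt_of_le_of_ne h ?_⟩
  rw [Ne, EmbeddingLike.apply_eq_iff_eq, Fin.mk.injEq]
  omega

theorem mul_add_mul_of_commute {A : Type*} [Semiring A] {c u : A} (h : Commute c u)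
    (s x y v : A) : s * (u * x * v) + s * c * (u * y * v) = s * (u * (x + c * y) * v) := by
  have e : c * (u * y * v) = u * (c * y) * v := by
    rw [← mul_assoc, ← mul_assoc, h.eq, mul_assoc u]
  rw [mul_assoc s, e, ← mul_add, ← add_mul, ← mul_add]

/-- Adjacent columns `k`, `k + 1` enter `colMinor` through quadratic minors. -/
theorem colMinor_eq_sum_quadMinor {k l : ℕ} (hr : r = k + 2 + l) (I : Idx r N)
    (j : Fin r → Fin N) :
    colMinor q I j = ∑ σ : Equiv.Perm (Fin r) with σ ⟨k, by omega⟩ < σ ⟨k + 1, by omega⟩,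
      muL q N (S q σ I) *
        ((List.ofFn fun i : Fin k => t q (I (σ ⟨i, by omega⟩)) (j ⟨i, by omega⟩)).prod
          * quadMinor q (I (σ ⟨k, by omega⟩)) (I (σ ⟨k + 1, by omega⟩))
              (j ⟨k, by omega⟩) (j ⟨k + 1, by omega⟩)
          * (List.ofFn fun i : Fin l =>
              t q (I (σ ⟨k + 2 + i, by omega⟩)) (j ⟨k + 2 + i, by omega⟩)).prod) := by
  have hk : k + 1 < r := by omega
  rw [colMinor, sum_perm_eq_sum_swap hk]
  refine Finset.sum_congr rfl fun σ hσ => ?_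
  replace hσ := (Finset.mem_filter.1 hσ).2
  rw [S_mul_swap q hk I σ hσ, prod_ofFn_split hr, prod_ofFn_split hr]
  have hA : ∀ i : Fin k, Equiv.swap (⟨k, by omega⟩ : Fin r) ⟨k + 1, hk⟩ ⟨i, by omega⟩
      = ⟨i, by omega⟩ := fun i => swap_succ_apply_of_ne hk _ (by omega) (by omega)
  have hB : ∀ i : Fin l, Equiv.swap (⟨k, by omega⟩ : Fin r) ⟨k + 1, hk⟩ ⟨k + 2 + i, by omega⟩
      = ⟨k + 2 + i, by omega⟩ := fun i => swap_succ_apply_of_ne hk _ (by omega) (by omega)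
  simp only [Equiv.Perm.mul_apply, hA, hB, Equiv.swap_apply_left, Equiv.swap_apply_right]
  -- The new sign factor involves only the rows at positions `k` and `k + 1`. These do not occur
  -- among the first `k` factors, so it moves right to the quadratic part.
  have hc : Commute (muL q N (-hfun q (I (σ ⟨k + 1, hk⟩)) (I (σ ⟨k, by omega⟩))))
      (List.ofFn fun i : Fin k => t q (I (σ ⟨i, by omega⟩)) (j ⟨i, by omega⟩)).prod := by
    refine commute_prod_ofFn fun i => commute_muL_t q _ (shift_neg_hfun q ?_ ?_)
    · rw [Ne, EmbeddingLike.apply_eq_iff_eq, EmbeddingLike.apply_eq_iff_eq, Fin.mk.injEq]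
      omega
    · rw [Ne, EmbeddingLike.apply_eq_iff_eq, EmbeddingLike.apply_eq_iff_eq, Fin.mk.injEq]
      omega
  rw [map_mul]
  exact mul_add_mul_of_commute hc _ _ _ _

theorem colMinor_eq_zero_of_adjacent {k : ℕ} (hk : k + 1 < r) (I : Idx r N) (j : Fin r → Fin N)
    (h : j ⟨k, by omega⟩ = j ⟨k + 1, hk⟩) : colMinor q I j = 0 := by
  rw [colMinor_eq_sum_quadMinor q (show r = k + 2 + (r - (k + 2)) by omega)]
  refine Finset.sum_eq_zero fun σ hσ => ?_
  replace hσ := (Finset.mem_filter.1 hσ).2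
  rw [h, quadMinor_self q _ (I.strictMono hσ), mul_zero, zero_mul, mul_zero]

/-- The function `f` from the quadratic exchange passes the first `k` factors as `f'` and then
commutes with the signs in `λ`. Leaving `f` and `f'` free covers both exchange directions and
repeated columns. -/
theorem colMinor_exchange {k : ℕ} (hk : k + 1 < r) (I : Idx r N) (j : Fin r → Fin N)
    {f f' : Mero N}
    (hf : ∀ a b, a < b → quadMinor q a b (j ⟨k, by omega⟩) (j ⟨k + 1, hk⟩)
      = muR q N f * quadMinor q a b (j ⟨k + 1, hk⟩) (j ⟨k, by omega⟩))
    (hf' : ∀ x : Fin k → Fin N,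
      (List.ofFn fun i : Fin k => t q (x i) (j ⟨i, by omega⟩)).prod * muR q N f
        = muR q N f' * (List.ofFn fun i : Fin k => t q (x i) (j ⟨i, by omega⟩)).prod) :
    colMinor q I j
      = muR q N f' * colMinor q I (j ∘ Equiv.swap ⟨k, by omega⟩ ⟨k + 1, hk⟩) := by
  have hr : r = k + 2 + (r - (k + 2)) := by omega
  rw [colMinor_eq_sum_quadMinor q hr, colMinor_eq_sum_quadMinor q hr, Finset.mul_sum]
  refine Finset.sum_congr rfl fun σ hσ => ?_
  replace hσ := (Finset.mem_filter.1 hσ).2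
  have hA : ∀ i : Fin k, Equiv.swap (⟨k, by omega⟩ : Fin r) ⟨k + 1, hk⟩ ⟨i, by omega⟩
      = ⟨i, by omega⟩ := fun i => swap_succ_apply_of_ne hk _ (by omega) (by omega)
  have hB : ∀ i : Fin (r - (k + 2)),
      Equiv.swap (⟨k, by omega⟩ : Fin r) ⟨k + 1, hk⟩ ⟨k + 2 + i, by omega⟩
        = ⟨k + 2 + i, by omega⟩ := fun i => swap_succ_apply_of_ne hk _ (by omega) (by omega)
  simp only [Function.comp_apply, hA, hB, Equiv.swap_apply_left, Equiv.swap_apply_right]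
  rw [hf _ _ (I.strictMono hσ), ← mul_assoc _ (muR q N f),
    hf' fun i : Fin k => I (σ ⟨i, by omega⟩), ← mul_assoc (muR q N f'), ← (muL_muR q _ _).eq]
  simp only [mul_assoc]

theorem colMinor_swap {k : ℕ} (hk : k + 1 < r) (I : Idx r N) {j : Fin r → Fin N}
    (hj : Function.Injective j) (h : j ⟨k + 1, hk⟩ < j ⟨k, by omega⟩) :
    colMinor q I j = muR q N (-hfun q (j ⟨k, by omega⟩) (j ⟨k + 1, hk⟩))
      * colMinor q I (j ∘ Equiv.swap ⟨k, by omega⟩ ⟨k + 1, hk⟩) := by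
  refine colMinor_exchange q hk I j (fun a b hab => quadMinor_swap q hab h) fun x => ?_
  refine (commute_prod_ofFn fun i => commute_muR_t q _ (shift_neg_hfun q ?_ ?_)).eq.symm
  · rw [Ne, hj.eq_iff, Fin.mk.injEq]
    omega
  · rw [Ne, hj.eq_iff, Fin.mk.injEq]
    omega

/-- Turning an ascent of `ρ` into a descent multiplies both sides by the same factor:
`colMinor_swap` on the left, `S_mul_swap` on the right. -/
theorem colMinor_comp_perm (I J : Idx r N) (ρ : Equiv.Perm (Fin r)) :
    colMinor q I (J ∘ ρ) = muR q N (S q ρ J) * colMinor q I J := by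
  induction ρ using perm_induction_descent with
  | one =>
    have : S q 1 J = 1 := by
      refine Finset.prod_eq_one fun p hp => ?_
      have hp' := (Finset.mem_filter.1 hp).2
      exact absurd hp'.1 hp'.2.asymm
    rw [this, map_one, one_mul]
    rfl
  | step σ k hk h ih =>
    have hs : (⇑J ∘ ⇑(σ * Equiv.swap (⟨k, by omega⟩ : Fin r) ⟨k + 1, hk⟩))
        ∘ Equiv.swap (⟨k, by omega⟩ : Fin r) ⟨k + 1, hk⟩ = J ∘ σ := by
      funext x
      simp
    rw [colMinor_swap q hk I (J.injective.comp (Equiv.injective _)) (by simpa using h), hs, ih,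
      S_mul_swap q hk J σ h, mul_comm (S q σ J), map_mul, mul_assoc]
    simp

theorem minor_eq_colMinor {q : ℂ} (hq0 : q ≠ 0) (hq2 : q ^ 2 ≠ 1) (ρ : Equiv.Perm (Fin r))
    (I J : Idx r N) : minor q ρ I J = colMinor q I J := by
  have h := colMinor_comp_perm q I J ρ
  have hinv : (S q ρ J)⁻¹ * S q ρ J = 1 := inv_mul_cancel₀ (S_ne_zero hq0 hq2 ρ J)
  change muR q N (S q ρ J)⁻¹ * colMinor q I (J ∘ ρ) = _
  rw [h, ← mul_assoc, ← map_mul, hinv, map_one, one_mul]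

theorem colMinor_eq_zero {q : ℂ} (hq0 : q ≠ 0) (hq2 : q ^ 2 ≠ 1) (I : Idx r N)
    {j : Fin r → Fin N} (hj : ¬Function.Injective j) : colMinor q I j = 0 := by
  -- Here `d` counts the positions strictly between two equal columns. Adjacent exchanges bring the
  -- right copy next to the left one at the cost of a factor in `μ`.
  have key : ∀ (d a : ℕ) (h : a + d + 1 < r) (j : Fin r → Fin N),
      j ⟨a, by omega⟩ = j ⟨a + d + 1, h⟩ → colMinor q I j = 0 := by
    intro d
    induction d with
    | zero => exact fun a h j hj => colMinor_eq_zero_of_adjacent q h I j hj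
    | succ d ih =>
      intro a h j hj
      by_cases he : j ⟨a + d + 1, by omega⟩ = j ⟨a + d + 1 + 1, h⟩
      · exact colMinor_eq_zero_of_adjacent q h I j he
      · obtain ⟨f, hf⟩ := exists_quadMinor_swap hq0 hq2 he
        obtain ⟨f', hf'⟩ :=
          exists_prod_t_mul_muR q (fun i : Fin (a + d + 1) => j ⟨i, by omega⟩) f
        rw [colMinor_exchange q h I j hf hf', ih a (by omega), mul_zero]
        have e1 := swap_succ_apply_of_ne h (i := a) (by omega) (by omega) (by omega)
        have e2 := Equiv.swap_apply_left (⟨a + d + 1, by omega⟩ : Fin r) ⟨a + d + 1 + 1, h⟩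
        exact (congrArg j e1).trans (hj.trans (congrArg j e2).symm)
  rw [Function.Injective] at hj
  push Not at hj
  obtain ⟨x, y, hxy, hne⟩ := hj
  wlog hlt : x < y generalizing x y
  · exact this y x hxy.symm hne.symm (lt_of_le_of_ne (not_lt.1 hlt) hne.symm)
  have hlt' : x.1 < y.1 := hlt
  refine key (y.1 - x.1 - 1) x.1 (by omega) j ?_
  rw [Fin.eta, hxy]
  congr 1
  ext
  simp only
  omega

end ColMinor

/-! ### Shuffles -/

section Shuffles
variable {m n : ℕ}

/-- The permutation of `[1, nm]` that permutes the `k`-th block by `τ k`. -/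
def blockPerm (τ : Fin n → Equiv.Perm (Fin m)) : Equiv.Perm (Fin (n * m)) :=
  finProdFinEquiv.symm.trans ((Equiv.prodCongrRight τ).trans finProdFinEquiv)

theorem blockPerm_apply (τ : Fin n → Equiv.Perm (Fin m)) (k : Fin n) (s : Fin m) :
    blockPerm τ (finProdFinEquiv (k, s)) = finProdFinEquiv (k, τ k s) := by
  rw [blockPerm, Equiv.trans_apply, Equiv.trans_apply, Equiv.symm_apply_apply]
  rfl

theorem finProdFinEquiv_lt_iff {x y : Fin n × Fin m} :
    finProdFinEquiv x < finProdFinEquiv y ↔ x.1 < y.1 ∨ x.1 = y.1 ∧ x.2 < y.2 := by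
  obtain ⟨⟨k, hk⟩, ⟨s, hs⟩⟩ := x
  obtain ⟨⟨k', hk'⟩, ⟨s', hs'⟩⟩ := y
  simp only [Fin.lt_def, Fin.mk.injEq, finProdFinEquiv_apply_val]
  rcases lt_trichotomy k k' with h | h | h
  · have : m * (k + 1) ≤ m * k' := Nat.mul_le_mul_left m h
    rw [mul_add] at this
    omega
  · subst h
    omega
  · have : m * (k' + 1) ≤ m * k := Nat.mul_le_mul_left m h
    rw [mul_add] at this
    omega

/-- An increasing sequence is determined by its set of values, which gives uniqueness. Sorting the
values of a permutation inside each block gives existence. -/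
theorem mul_blockPerm_bijective : Function.Bijective
    fun p : Shuffle m n × (Fin n → Equiv.Perm (Fin m)) => p.1.1 * blockPerm p.2 := by
  constructor
  · rintro ⟨σ, τ⟩ ⟨σ', τ'⟩ h
    have happ : ∀ k s, σ.1 (finProdFinEquiv (k, τ k s)) = σ'.1 (finProdFinEquiv (k, τ' k s)) :=
      fun k s => by
        have := Equiv.congr_fun h (finProdFinEquiv (k, s))
        simpa only [Equiv.Perm.mul_apply, blockPerm_apply] using this
    have hσ : σ = σ' := by
      refine Subtype.ext (Equiv.ext fun x => ?_)
      obtain ⟨⟨k, s⟩, rfl⟩ := finProdFinEquiv.surjective x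
      refine congrFun (((σ.2 k).range_inj (σ'.2 k)).1 ?_) s
      rw [← (τ k).surjective.range_comp (fun s => σ.1 (finProdFinEquiv (k, s))),
        ← (τ' k).surjective.range_comp (fun s => σ'.1 (finProdFinEquiv (k, s)))]
      exact congrArg Set.range (funext fun s => happ k s)
    subst hσ
    refine Prod.ext rfl (funext fun k => Equiv.ext fun s => ?_)
    exact (σ.2 k).injective (happ k s)
  · intro π
    let f : Fin n → Fin m → Fin (n * m) := fun k s => π (finProdFinEquiv (k, s))
    have hf : ∀ k, Function.Injective (f k) := fun k s s' h => by
      simpa using finProdFinEquiv.injective (π.injective h)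
    refine ⟨⟨⟨π * blockPerm fun k => Tuple.sort (f k), fun k => ?_⟩,
      fun k => (Tuple.sort (f k)).symm⟩, Equiv.ext fun x => ?_⟩
    · simp only [Equiv.Perm.mul_apply, blockPerm_apply]
      exact (Tuple.monotone_sort (f k)).strictMono_of_injective
        ((hf k).comp (Equiv.injective _))
    · obtain ⟨⟨k, s⟩, rfl⟩ := finProdFinEquiv.surjective x
      simp only [Equiv.Perm.mul_apply, blockPerm_apply, Equiv.apply_symm_apply]

/-- The inversions between distinct blocks and the inversions inside the blocks. -/
theorem invProd_eq_blocks {A : Type*} [CommMonoid A] (F : Fin (n * m) → Fin (n * m) → A)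
    (π : Equiv.Perm (Fin (n * m))) :
    invProd F π =
      (∏ x : Fin n × Fin m, ∏ y : Fin n × Fin m,
        if x.1 < y.1 ∧ π (finProdFinEquiv y) < π (finProdFinEquiv x)
          then F (π (finProdFinEquiv x)) (π (finProdFinEquiv y)) else 1)
      * ∏ k : Fin n, ∏ p : Fin m × Fin m with
          p.1 < p.2 ∧ π (finProdFinEquiv (k, p.2)) < π (finProdFinEquiv (k, p.1)),
          F (π (finProdFinEquiv (k, p.1))) (π (finProdFinEquiv (k, p.2))) := by
  have hin : (∏ k : Fin n, ∏ p : Fin m × Fin m with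
        p.1 < p.2 ∧ π (finProdFinEquiv (k, p.2)) < π (finProdFinEquiv (k, p.1)),
        F (π (finProdFinEquiv (k, p.1))) (π (finProdFinEquiv (k, p.2))))
      = ∏ x : Fin n × Fin m, ∏ y : Fin n × Fin m,
        if x.1 = y.1 ∧ x.2 < y.2 ∧ π (finProdFinEquiv y) < π (finProdFinEquiv x)
          then F (π (finProdFinEquiv x)) (π (finProdFinEquiv y)) else 1 := by
    simp only [Finset.prod_filter, Fintype.prod_prod_type]
    refine Finset.prod_congr rfl fun k _ => Finset.prod_congr rfl fun s _ => ?_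
    rw [Finset.prod_eq_single k]
    · simp
    · intro k' _ hk'
      simp [hk'.symm]
    · simp
  rw [hin, ← Finset.prod_mul_distrib, invProd, Finset.prod_filter, Fintype.prod_prod_type,
    ← Equiv.prod_comp finProdFinEquiv]
  refine Finset.prod_congr rfl fun x _ => ?_
  rw [← Equiv.prod_comp finProdFinEquiv, ← Finset.prod_mul_distrib]
  refine Finset.prod_congr rfl fun y _ => ?_
  simp only [finProdFinEquiv_lt_iff]
  by_cases h1 : x.1 < y.1
  · simp [h1, h1.ne]
  · simp [h1, and_assoc]

/-- Inversions between distinct blocks depend only on the sets of values of the blocks, which `τ`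
preserves. Inside block `k`, where `σ` is increasing, the inversions are those of `τ k`. -/
theorem S_mul_blockPerm (q : ℂ) (σ : Shuffle m n) (τ : Fin n → Equiv.Perm (Fin m)) :
    S q (σ.1 * blockPerm τ) (RelEmbedding.refl _ : Idx (n * m) (n * m))
      = S q σ.1 (RelEmbedding.refl _) * ∏ k, S q (τ k) (block σ k) := by
  rw [S_eq_invProd, S_eq_invProd, invProd_eq_blocks, invProd_eq_blocks _ σ.1]
  congr 1
  · rw [Finset.prod_eq_one (s := Finset.univ) (f := fun k : Fin n => _), mul_one]
    · symm
      rw [← Equiv.prod_comp (Equiv.prodCongrRight τ)]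
      refine Finset.prod_congr rfl fun ⟨k, s⟩ _ => ?_
      rw [← Equiv.prod_comp (Equiv.prodCongrRight τ)]
      refine Finset.prod_congr rfl fun ⟨k', s'⟩ _ => ?_
      simp only [Equiv.Perm.mul_apply, blockPerm_apply]
      rfl
    · intro k _
      refine Finset.prod_eq_one fun p hp => ?_
      have hp' := (Finset.mem_filter.1 hp).2
      exact absurd hp'.2 (σ.2 k hp'.1).asymm
  · refine Finset.prod_congr rfl fun k _ => ?_
    simp only [Equiv.Perm.mul_apply, blockPerm_apply]
    refine Finset.prod_congr (Finset.filter_congr fun p _ => ?_) fun p _ => rfl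
    exact and_congr_right fun _ => (σ.2 k).lt_iff_lt

theorem prod_ofFn_blocks {A : Type*} [Monoid A] (f : Fin (n * m) → A) :
    (List.ofFn f).prod
      = (List.ofFn fun k : Fin n => (List.ofFn fun s : Fin m => f (finProdFinEquiv (k, s))).prod).prod
      := by
  rw [List.ofFn_mul, List.prod_flatten, List.map_ofFn]
  congr 2
  funext k
  simp only [Function.comp_apply]
  congr 2
  funext s
  congr 1
  ext
  simp [mul_comm, add_comm]

/-- The sequence of columns obtained by concatenating the `J k`. -/
def concat {N : ℕ} (J : Fin n → Idx m N) (p : Fin (n * m)) : Fin N :=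
  J (finProdFinEquiv.symm p).1 (finProdFinEquiv.symm p).2

theorem concat_apply {N : ℕ} (J : Fin n → Idx m N) (k : Fin n) (s : Fin m) :
    concat J (finProdFinEquiv (k, s)) = J k s := by
  rw [concat, Equiv.symm_apply_apply]

theorem concat_block (σ : Shuffle m n) : concat (block σ) = σ.1 := by
  funext x
  obtain ⟨⟨k, s⟩, rfl⟩ := finProdFinEquiv.surjective x
  rw [concat_apply]
  rfl

theorem exists_block_eq {J : Fin n → Idx m (n * m)} (hJ : Function.Injective (concat J)) :
    ∃ σ : Shuffle m n, block σ = J := by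
  refine ⟨⟨Equiv.ofBijective _ (Finite.injective_iff_bijective.1 hJ), fun k => ?_⟩, ?_⟩
  · simp only [Equiv.ofBijective_apply, concat_apply]
    exact (J k).strictMono
  · funext k
    refine DFunLike.ext _ _ fun s => ?_
    exact concat_apply J k s

theorem block_injective : Function.Injective (block : Shuffle m n → Fin n → Idx m (n * m)) := by
  intro σ σ' h
  refine Subtype.ext (DFunLike.coe_injective ?_)
  rw [← concat_block, ← concat_block, h]

/-- Laplace expansion of `colMinor` into blocks of `m` columns. -/
theorem sum_shuffle_prod_colMinor (q : ℂ) (J : Fin n → Idx m (n * m)) :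
    ∑ σ : Shuffle m n, muL q (n * m) (S q σ.1 (RelEmbedding.refl _))
        * (List.ofFn fun k => colMinor q (block σ k) (J k)).prod
      = colMinor q (RelEmbedding.refl _) (concat J) := by
  rw [colMinor, ← mul_blockPerm_bijective.sum_comp, Fintype.sum_prod_type]
  refine Finset.sum_congr rfl fun σ _ => ?_
  simp only [colMinor]
  rw [prod_ofFn_sum, Finset.mul_sum]
  refine Finset.sum_congr rfl fun τ _ => ?_
  rw [prod_ofFn_mul, S_mul_blockPerm, map_mul, mul_assoc]
  · congr 1
    rw [prod_ofFn_blocks]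
    congr 1
    · rw [← List.prod_ofFn, map_list_prod, List.map_ofFn]
      rfl
    · simp only [Equiv.Perm.mul_apply, blockPerm_apply, concat_apply]
      rfl
  -- The sign of block `k` involves only rows of that block, so the factors `t` of another block `l`
  -- do not shift it.
  · intro k l hkl
    refine commute_prod_ofFn fun s => commute_muL_t q _ (shift_S q _ _ fun s' h => hkl ?_)
    have := finProdFinEquiv.injective (σ.1.injective h)
    exact (congrArg Prod.fst this).symm

end Shuffles

/-! ### The tensor product -/

section Tensor
variable {m n : ℕ}

theorem muR_mul_mem {q : ℂ} {N : ℕ} {α β : Fin N → ℕ} {x : FR q N} (f : Mero N)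
    (hx : x ∈ FDeg q N α β) : muR q N f * x ∈ FDeg q N α β := by
  have h := FDeg.mul_mem (Submodule.subset_span (FMonomial.mu f)) hx
  rwa [zero_add, zero_add] at h

theorem fnB_mul_mem {N : ℕ} {β : Fin N → ℕ} {y : BAlg m N} (f : Mero N)
    (hy : y ∈ BDeg m N β) : fnB m N f * y ∈ BDeg m N β := by
  have h := BDeg.mul_mem (Submodule.subset_span (BMonomial.fn f)) hy
  rwa [zero_add] at h

theorem prod_b_mem (σ : Shuffle m n) : (List.ofFn fun k => b (block σ k)).prod
    ∈ BDeg m (n * m) (wtIdx (RelEmbedding.refl _ : Idx (n * m) (n * m))) := by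
  have h1 := BDeg.prod_mem (fun k => wtIdx (block σ k)) (fun k => b (block σ k)) fun k => b_mem _
  have h2 : ∑ k, wtIdx (block σ k) = wtIdx (RelEmbedding.refl _ : Idx (n * m) (n * m)) := by
    have h3 : ∑ k, wtIdx (block σ k)
        = ∑ p : Fin n × Fin m, wt (σ.1 (finProdFinEquiv p)) := by
      rw [Fintype.sum_prod_type]
      rfl
    rw [h3, Equiv.sum_comp finProdFinEquiv (fun p => wt (σ.1 p)),
      Equiv.sum_comp σ.1 (fun p => wt p)]
    rfl
  rwa [h2] at h1

/-- The expansion of `Pf_m(C)` in `F_R(M(nm)) ⊗ B`, before passing to the quotient. -/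
theorem hyperPf_minor_tmul {q : ℂ} (hq0 : q ≠ 0) (hq2 : q ^ 2 ≠ 1)
    (ρ : Idx m (n * m) → Idx m (n * m) → Equiv.Perm (Fin m)) (ρ' : Equiv.Perm (Fin (n * m))) :
    ∑ σ : Shuffle m n,
      (muL q (n * m) (S q σ.1 (RelEmbedding.refl _)) ⊗ₜ[ℂ] (1 : BAlg m (n * m)))
        * (List.ofFn fun k : Fin n => ∑ J : Idx m (n * m),
            minor q (ρ (block σ k) J) (block σ k) J ⊗ₜ[ℂ] b J).prod
      = ∑ σ : Shuffle m n, (muR q (n * m) (S q σ.1 (RelEmbedding.refl _)) * qdet q ρ')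
          ⊗ₜ[ℂ] (List.ofFn fun k : Fin n => b (block σ k)).prod := by
  simp only [qdet, minor_eq_colMinor hq0 hq2, prod_ofFn_sum, prod_ofFn_tmul, Finset.mul_sum,
    Algebra.TensorProduct.tmul_mul_tmul, one_mul]
  -- With the family `J` fixed outside, the inner sum over shuffles is the Laplace expansion.
  rw [Finset.sum_comm]
  simp only [← TensorProduct.sum_tmul, sum_shuffle_prod_colMinor]
  symm
  refine Finset.sum_of_injOn block block_injective.injOn (fun _ _ => Finset.mem_coe.2
    (Finset.mem_univ _)) (fun J _ hJ => ?_) fun σ _ => ?_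
  · rw [colMinor_eq_zero hq0 hq2, TensorProduct.zero_tmul]
    intro hinj
    obtain ⟨σ, rfl⟩ := exists_block_eq hinj
    exact hJ ⟨σ, Finset.mem_coe.2 (Finset.mem_univ _), rfl⟩
  · rw [concat_block, ← colMinor_comp_perm]
    rfl

/-- The defining relation of the tensor product moves each `μ_r(S(σ))` across, where it becomes the
coefficient `S(σ)` in `Pf_m(B)`. -/
theorem tmul_pfB (q : ℂ) (ρ' : Equiv.Perm (Fin (n * m))) :
    RingQuot.mkAlgHom ℂ (TensorRel q m (n * m)) (∑ σ : Shuffle m n,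
      preTmul ⟨_, muR_mul_mem (S q σ.1 (RelEmbedding.refl _)) (qdet_mem q ρ')⟩
        ⟨_, prod_b_mem σ⟩)
      = tmul ⟨qdet q ρ', qdet_mem q ρ'⟩ ⟨pfB q m n, pfB_mem q m n⟩ := by
  have h : ∀ σ : Shuffle m n, RingQuot.mkAlgHom ℂ (TensorRel q m (n * m))
      (preTmul ⟨_, muR_mul_mem (S q σ.1 (RelEmbedding.refl _)) (qdet_mem q ρ')⟩
        ⟨_, prod_b_mem σ⟩) = RingQuot.mkAlgHom ℂ (TensorRel q m (n * m))
      (preTmul ⟨_, qdet_mem q ρ'⟩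
        ⟨_, fnB_mul_mem (S q σ.1 (RelEmbedding.refl _)) (prod_b_mem σ)⟩) := fun σ =>
    RingQuot.mkAlgHom_rel ℂ (TensorRel.mk (S q σ.1 (RelEmbedding.refl _)) _ _ _ _ rfl rfl)
  rw [map_sum, Finset.sum_congr rfl fun σ _ => h σ, ← map_sum, tmul]
  congr 1
  apply Subtype.ext
  rw [AddSubmonoidClass.coe_finsetSum]
  exact (TensorProduct.tmul_sum _ _ _).symm

/-- `Pf_m(C)` is the class of its expansion in the subalgebra `⨁ F_{α β} ⊗ B_β`. -/
theorem hyperPf_c_eq (q : ℂ) (ρ : Idx m (n * m) → Idx m (n * m) → Equiv.Perm (Fin m)) :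
    ∃ x : preTensor q m (n * m),
      hyperPf q (fnT q m (n * m)) (c q ρ) = RingQuot.mkAlgHom ℂ (TensorRel q m (n * m)) x ∧
      (x : FR q (n * m) ⊗[ℂ] BAlg m (n * m)) = ∑ σ : Shuffle m n,
        (muL q (n * m) (S q σ.1 (RelEmbedding.refl _)) ⊗ₜ[ℂ] (1 : BAlg m (n * m)))
          * (List.ofFn fun k : Fin n => ∑ J : Idx m (n * m),
              minor q (ρ (block σ k) J) (block σ k) J ⊗ₜ[ℂ] b J).prod := by
  -- `φ` and `y` lift `fnT` and `c` to the subalgebra, so the expansion can be computed in the full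
  -- tensor product.
  let φ : Mero (n * m) →ₐ[ℂ] preTensor q m (n * m) :=
    (Algebra.TensorProduct.includeLeft.comp (muL q (n * m))).codRestrict (preTensor q m (n * m))
      fun f => Algebra.subset_adjoin ⟨0, 0, muL q (n * m) f,
        Submodule.subset_span (FMonomial.lam f), 1,
        Submodule.subset_span (by simpa using BMonomial.fn (m := m) (N := n * m) 1), rfl⟩
  let y : Idx m (n * m) → preTensor q m (n * m) := fun I => ∑ J : Idx m (n * m),
    preTmul ⟨minor q (ρ I J) I J, minor_mem q (ρ I J) I J⟩ ⟨b J, b_mem J⟩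
  have hy : ∀ I, (y I : FR q (n * m) ⊗[ℂ] BAlg m (n * m))
      = ∑ J : Idx m (n * m), minor q (ρ I J) I J ⊗ₜ[ℂ] b J := fun I => by
    rw [AddSubmonoidClass.coe_finsetSum]
    rfl
  have hc : ∀ I, c q ρ I = RingQuot.mkAlgHom ℂ (TensorRel q m (n * m)) (y I) := fun I => by
    rw [map_sum]
    rfl
  refine ⟨∑ σ : Shuffle m n, φ (S q σ.1 (RelEmbedding.refl _))
    * (List.ofFn fun k : Fin n => y (block σ k)).prod, ?_, ?_⟩
  · rw [hyperPf, map_sum]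
    refine Finset.sum_congr rfl fun σ _ => ?_
    rw [map_mul, map_list_prod, List.map_ofFn]
    simp only [hc]
    rfl
  · rw [AddSubmonoidClass.coe_finsetSum]
    refine Finset.sum_congr rfl fun σ _ => ?_
    rw [MulMemClass.coe_mul, SubmonoidClass.coe_list_prod, List.map_ofFn]
    simp only [← hy]
    rfl

end Tensor

end DynPf

end

theorem mainTheorem2 (q : ℂ) (hq0 : q ≠ 0) (hq : ∀ k : ℕ, 0 < k → q ^ k ≠ 1) (m n : ℕ)
    (ρ : DynPf.Idx m (n * m) → DynPf.Idx m (n * m) → Equiv.Perm (Fin m))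
    (ρ' : Equiv.Perm (Fin (n * m))) :
    DynPf.hyperPf q (DynPf.fnT q m (n * m)) (DynPf.c q ρ) =
      DynPf.tmul ⟨DynPf.qdet q ρ', DynPf.qdet_mem q ρ'⟩ ⟨DynPf.pfB q m n, DynPf.pfB_mem q m n⟩ := by
  obtain ⟨x, hx, hx'⟩ := DynPf.hyperPf_c_eq q ρ
  rw [hx, ← DynPf.tmul_pfB]
  -- After `tmul_pfB` the two sides agree before passing to the quotient, and equality can be
  -- checked in the full tensor product.
  congr 1
  apply Subtype.ext
  rw [hx', DynPf.hyperPf_minor_tmul hq0 (hq 2 two_pos) ρ ρ', AddSubmonoidClass.coe_finsetSum]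
  rfl
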